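/- Let $c>0$ be an integer, let $\mu,\nu\in\mathbb R$, and write $e(x)=e^{2\pi i x}$. Let $D_0$ be the $*$-algebra of finitely supported families $F=(F(p,\cdot))_{p\in\mathbb Z}$ of bounded continuous functions on $\mathbb R\times S^1$, $S^1=\mathbb R/\mathbb Z$, satisfying $F(p,x+1,y)=e(-cp(y-p\nu))\,F(p,x,y)$, with product and involution $$(F_1F_2)(p,x,y)=\sum_{q\in\mathbb Z}F_1(q,x,y)\,F_2(p-q,x-2q\mu,y-2q\nu),\qquad F^*(p,x,y)=\overline{F(-p,x-2p\mu,y-2p\nu)}.$$ The quantum Heisenberg manifold $\mathcal D=\mathcal D^{c}_{\mu,\nu}$ is the completion of $D_0$ for the universal $C^*$-norm $\|F\|=\sup_\rho\|\rho(F)\|$, where $\rho$ runs over all $*$-homomorphisms from $D_0$ to $C^*$-algebras. Let $\mathbb H=\mathbb R^3$ be the Heisenberg group with group law $(r,s,t)(r',s',t')=(r+r',\,s+s',\,t+t'+c\,s\,r')$. It acts on $\mathcal D$ by the automorphisms that are given on $D_0$ by $$\alpha_{(r,s,t)}(F)(p,x,y)=e\big(-p\,(t+cs(x-r-p\mu))\big)\,F(p,x-r,y-s).$$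 The smooth quantum Heisenberg manifold is the subalgebra $\mathcal D^\infty=\{a\in\mathcal D : g\mapsto\alpha_g(a)\in C^\infty(\mathbb H\to\mathcal D)\}$. For $a\in\mathcal D^\infty$ let $$\partial_1a=\tfrac{d}{dh}\Big|_{h=0}\alpha_{(h,0,0)}(a),\qquad \partial_2a=\tfrac{d}{dh}\Big|_{h=0}\alpha_{(0,h,0)}(a),\qquad \partial_3a=\tfrac{d}{dh}\Big|_{h=0}\alpha_{(0,0,h)}(a),$$ and let $\tau\colon\mathcal D\to\mathbb C$ be the continuous extension of the trace $F\mapsto\int_0^1\int_0^1F(0,x,y)\,dy\,dx$ on $D_0$. A cyclic cocycle of degree $n$ on a complex algebra $A$ is an $(n+1)$-linear form $\varphi$ on $A$ such that $\varphi(a_0,\dots,a_n)=(-1)^n\varphi(a_n,a_0,\dots,a_{n-1})$ and $$\sum_{j=0}^n(-1)^j\varphi(a_0,\dots,a_ja_{j+1},\dots,a_{n+1})+(-1)^{n+1}\varphi(a_{n+1}a_0,a_1,\dots,a_n)=0 .$$ Then the following seven forms are cyclic cocycles on $\mathcal D^\infty$: * in degree $0$: the trace $\tau$; * in degree $1$: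 $\varphi_i(a_0,a_1)=\tau\big(a_0\,\partial_i(a_1)\big)$ for $i=1,2,3$; * in degree $2$: $\varphi_{i,3}(a_0,a_1,a_2)=\tau\Big(a_0\big(\partial_i(a_1)\,\partial_3(a_2)-\partial_3(a_1)\,\partial_i(a_2)\big)\Big)$ for $i=1,2$; * in degree $3$: $\varphi_{1,2,3}(a_0,a_1,a_2,a_3)=\sum_{\sigma\in\Sigma_3}\varepsilon(\sigma)\,\tau\big(a_0\,\partial_{\sigma(1)}(a_1)\,\partial_{\sigma(2)}(a_2)\,\partial_{\sigma(3)}(a_3)\big)$. -/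

import Mathlib

noncomputable section

namespace QHM

/-- `e x = exp (2 π i x)`. -/
def e (x : ℝ) : ℂ := Complex.exp (2 * Real.pi * Complex.I * x)

lemma e_add (x y : ℝ) : e (x + y) = e x * e y := by
  simp only [e]; rw [← Complex.exp_add]; congr 1; push_cast; ring

lemma e_zero : e 0 = 1 := by simp [e]

lemma e_int (n : ℤ) : e n = 1 := by
  simp only [e]; rw [Complex.exp_eq_one_iff]; exact ⟨n, by push_cast; ring⟩

lemma conj_e (x : ℝ) : (starRingEnd ℂ) (e x) = e (-x) := by
  simp only [e]; rw [← Complex.exp_conj]; congr 1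
  simp [Complex.conj_ofNat]

lemma norm_e (x : ℝ) : ‖e x‖ = 1 := by
  simp only [e]
  rw [show (2 * Real.pi * Complex.I * x : ℂ) = ((2 * Real.pi * x : ℝ) : ℂ) * Complex.I by
    push_cast; ring]
  exact Complex.norm_exp_ofReal_mul_I _

lemma continuous_e : Continuous e := by unfold e; fun_prop

/-- Elements of the dense `*`-algebra `D₀` of the quantum Heisenberg manifold with parameters
`c, μ, ν`: finitely supported families `F(p, ·)`, `p ∈ ℤ`, of continuous functions on `ℝ × S¹`
(that is, continuous functions on `ℝ × ℝ` of period `1` in the second variable) with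
`F(p, x + 1, y) = e(-c p (y - p ν)) F(p, x, y)`. Boundedness of `F(p, ·)` is automatic, since its
absolute value is continuous and biperiodic. The parameter `μ` enters in the product. -/
@[ext]
structure Pre (c : ℤ) (μ ν : ℝ) where
  toFun : ℤ → ℝ → ℝ → ℂ
  cont' : ∀ p, Continuous fun z : ℝ × ℝ => toFun p z.1 z.2
  fin' : {p | toFun p ≠ 0}.Finite
  quasi' : ∀ p x y, toFun p (x + 1) y = e (-(c * p * (y - p * ν))) * toFun p x y
  peri' : ∀ p x y, toFun p x (y + 1) = toFun p x y

variable {c : ℤ} {μ ν : ℝ}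

namespace Pre

instance : CoeFun (Pre c μ ν) (fun _ => ℤ → ℝ → ℝ → ℂ) := ⟨toFun⟩

lemma ext' {F G : Pre c μ ν} (h : ∀ p x y, F p x y = G p x y) : F = G :=
  Pre.ext (by funext p x y; exact h p x y)

lemma cont (F : Pre c μ ν) (p : ℤ) : Continuous fun z : ℝ × ℝ => F p z.1 z.2 := F.cont' p

lemma quasi (F : Pre c μ ν) (p : ℤ) (x y : ℝ) :
    F p (x + 1) y = e (-(c * p * (y - p * ν))) * F p x y := F.quasi' p x y

lemma peri (F : Pre c μ ν) (p : ℤ) (x y : ℝ) : F p x (y + 1) = F p x y := F.peri' p x y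

lemma peri_int (F : Pre c μ ν) (p : ℤ) (x y : ℝ) (n : ℤ) : F p x (y + n) = F p x y := by
  have h : Function.Periodic (F p x) 1 := F.peri p x
  simpa using h.int_mul n y

/-- The finite set of degrees in which `F` does not vanish. -/
def supp (F : Pre c μ ν) : Finset ℤ := F.fin'.toFinset

lemma eq_zero_of_notMem {F : Pre c μ ν} {p : ℤ} (h : p ∉ F.supp) (x y : ℝ) : F p x y = 0 := by
  have : F p = 0 := by simpa [supp] using h
  rw [this]; rfl

/-- Constructor with a finite set outside which the family vanishes. -/
def mk' (f : ℤ → ℝ → ℝ → ℂ) (S : Finset ℤ) (hS : ∀ p ∉ S, ∀ x y, f p x y = 0)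
    (h1 : ∀ p, Continuous fun z : ℝ × ℝ => f p z.1 z.2)
    (h2 : ∀ p x y, f p (x + 1) y = e (-(c * p * (y - p * ν))) * f p x y)
    (h3 : ∀ p x y, f p x (y + 1) = f p x y) : Pre c μ ν where
  toFun := f
  cont' := h1
  fin' := S.finite_toSet.subset fun p hp => by
    by_contra h
    exact hp (by funext x y; exact hS p h x y)
  quasi' := h2
  peri' := h3

instance : Zero (Pre c μ ν) :=
  ⟨mk' (fun _ _ _ => 0) ∅ (by simp) (fun _ => continuous_const) (by simp) (by simp)⟩

instance : Add (Pre c μ ν) :=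
  ⟨fun F G => mk' (fun p x y => F p x y + G p x y) (F.supp ∪ G.supp)
    (fun p hp x y => by
      simp only [Finset.mem_union, not_or] at hp
      simp [eq_zero_of_notMem hp.1, eq_zero_of_notMem hp.2])
    (fun p => (F.cont p).add (G.cont p))
    (fun p x y => by simp only [quasi]; ring) (fun p x y => by simp only [peri])⟩

instance : SMul ℂ (Pre c μ ν) :=
  ⟨fun a F => mk' (fun p x y => a * F p x y) F.supp
    (fun p hp x y => by simp [eq_zero_of_notMem hp])
    (fun p => continuous_const.mul (F.cont p))
    (fun p x y => by simp only [quasi]; ring) (fun p x y => by simp only [peri])⟩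

instance : Neg (Pre c μ ν) := ⟨fun F => (-1 : ℂ) • F⟩

@[simp] lemma zero_apply (p : ℤ) (x y : ℝ) : (0 : Pre c μ ν) p x y = 0 := rfl

@[simp] lemma add_apply (F G : Pre c μ ν) (p : ℤ) (x y : ℝ) :
    (F + G) p x y = F p x y + G p x y := rfl

@[simp] lemma smul_apply (a : ℂ) (F : Pre c μ ν) (p : ℤ) (x y : ℝ) :
    (a • F) p x y = a * F p x y := rfl

@[simp] lemma neg_apply (F : Pre c μ ν) (p : ℤ) (x y : ℝ) : (-F) p x y = -F p x y := by
  change (-1 : ℂ) * F p x y = _; ring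

lemma finsum_eq (F : Pre c μ ν) (f : ℤ → ℂ) (x y : ℝ) :
    ∑ᶠ q, F q x y * f q = ∑ q ∈ F.supp, F q x y * f q := by
  apply finsum_eq_sum_of_support_subset
  intro q hq
  by_contra h
  exact hq (by simp [eq_zero_of_notMem (F := F) (p := q) (by simpa using h)])

/-- The product
`(F₁ F₂)(p, x, y) = ∑_q F₁(q, x, y) F₂(p - q, x - 2qμ, y - 2qν)`. -/
instance : Mul (Pre c μ ν) :=
  ⟨fun F G => mk'
    (fun p x y => ∑ᶠ q : ℤ, F q x y * G (p - q) (x - 2 * q * μ) (y - 2 * q * ν))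
    (Finset.image₂ (fun a b => a + b) F.supp G.supp)
    (fun p hp x y => by
      rw [finsum_eq]
      refine Finset.sum_eq_zero fun q hq => ?_
      rw [eq_zero_of_notMem (F := G), mul_zero]
      exact fun h => hp (Finset.mem_image₂.2 ⟨q, hq, p - q, h, by ring⟩))
    (fun p => by
      simp only [finsum_eq]
      refine continuous_finsetSum _ fun q _ => (F.cont q).mul ?_
      exact (G.cont (p - q)).comp
        (by fun_prop : Continuous fun z : ℝ × ℝ => (z.1 - 2 * q * μ, z.2 - 2 * q * ν)))
    (fun p x y => by
      simp only [finsum_eq]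
      rw [Finset.mul_sum]
      refine Finset.sum_congr rfl fun q _ => ?_
      rw [show x + 1 - 2 * q * μ = x - 2 * q * μ + 1 by ring, quasi, quasi]
      have h : e (-(c * p * (y - p * ν))) = e (-(c * q * (y - q * ν))) *
          e (-(c * ((p - q : ℤ) : ℝ) * (y - 2 * q * ν - ((p - q : ℤ) : ℝ) * ν))) := by
        rw [← e_add]; congr 1; push_cast; ring
      rw [h]; ring)
    (fun p x y => by
      simp only [finsum_eq]
      refine Finset.sum_congr rfl fun q _ => ?_
      rw [show y + 1 - 2 * q * ν = y - 2 * q * ν + 1 by ring, peri, peri])⟩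

lemma mul_apply (F G : Pre c μ ν) (p : ℤ) (x y : ℝ) :
    (F * G) p x y = ∑ᶠ q : ℤ, F q x y * G (p - q) (x - 2 * q * μ) (y - 2 * q * ν) := rfl

lemma mul_apply' (F G : Pre c μ ν) (p : ℤ) (x y : ℝ) :
    (F * G) p x y = ∑ q ∈ F.supp, F q x y * G (p - q) (x - 2 * q * μ) (y - 2 * q * ν) := by
  rw [mul_apply, finsum_eq]

/-- The function `f` placed in degree `p`. -/
def single (p : ℤ) (f : ℝ → ℝ → ℂ) (h1 : Continuous fun z : ℝ × ℝ => f z.1 z.2)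
    (h2 : ∀ x y, f (x + 1) y = e (-(c * p * (y - p * ν))) * f x y)
    (h3 : ∀ x y, f x (y + 1) = f x y) : Pre c μ ν :=
  mk' (fun q x y => if q = p then f x y else 0) {p} (fun q hq x y => by simp_all)
    (fun q => by split_ifs <;> [exact h1; exact continuous_const])
    (fun q x y => by
      split_ifs with h
      · rw [h, h2]
      · simp)
    (fun q x y => by simp only [h3])

lemma single_mul_apply (p : ℤ) (f : ℝ → ℝ → ℂ) (h1 h2 h3) (G : Pre c μ ν) (n : ℤ) (x y : ℝ) :
    ((single p f h1 h2 h3 : Pre c μ ν) * G) n x y =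
      f x y * G (n - p) (x - 2 * p * μ) (y - 2 * p * ν) := by
  rw [mul_apply, finsum_eq_single _ p]
  · simp [single, mk']
  · intro q hq; simp [single, mk', hq]

instance : One (Pre c μ ν) :=
  ⟨single 0 (fun _ _ => 1) continuous_const (by simp [e_zero]) (by simp)⟩

lemma one_apply (p : ℤ) (x y : ℝ) : (1 : Pre c μ ν) p x y = if p = 0 then 1 else 0 := rfl

/-- The involution `F*(p, x, y) = conj F(-p, x - 2pμ, y - 2pν)`. -/
instance : Star (Pre c μ ν) :=
  ⟨fun F => mk'
    (fun p x y => (starRingEnd ℂ) (F (-p) (x - 2 * p * μ) (y - 2 * p * ν)))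
    (F.supp.image Neg.neg)
    (fun p hp x y => by
      rw [eq_zero_of_notMem, map_zero]
      exact fun h => hp (Finset.mem_image.2 ⟨-p, h, neg_neg p⟩))
    (fun p => Complex.continuous_conj.comp ((F.cont (-p)).comp
      (by fun_prop : Continuous fun z : ℝ × ℝ => (z.1 - 2 * p * μ, z.2 - 2 * p * ν))))
    (fun p x y => by
      rw [show x + 1 - 2 * p * μ = x - 2 * p * μ + 1 by ring, quasi, map_mul, conj_e]
      congr 2; push_cast; ring)
    (fun p x y => by rw [show y + 1 - 2 * p * ν = y - 2 * p * ν + 1 by ring, peri])⟩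

lemma star_apply (F : Pre c μ ν) (p : ℤ) (x y : ℝ) :
    (star F) p x y = (starRingEnd ℂ) (F (-p) (x - 2 * p * μ) (y - 2 * p * ν)) := rfl

instance : AddCommGroup (Pre c μ ν) where
  add_assoc F G H := ext' fun p x y => by simp [add_assoc]
  zero_add F := ext' fun p x y => by simp
  add_zero F := ext' fun p x y => by simp
  nsmul := nsmulRec
  zsmul := zsmulRec
  neg_add_cancel F := ext' fun p x y => by simp
  add_comm F G := ext' fun p x y => by simp [add_comm]

instance : Ring (Pre c μ ν) where
  __ := (inferInstance : AddCommGroup (Pre c μ ν))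
  left_distrib F G H := ext' fun p x y => by
    simp only [mul_apply', add_apply, mul_add, Finset.sum_add_distrib]
  right_distrib F G H := ext' fun p x y => by
    have key : ∀ K : Pre c μ ν, K.supp ⊆ F.supp ∪ G.supp ∪ (F + G).supp →
        (K * H) p x y = ∑ q ∈ F.supp ∪ G.supp ∪ (F + G).supp,
          K q x y * H (p - q) (x - 2 * q * μ) (y - 2 * q * ν) := fun K hK => by
      rw [mul_apply']
      refine Finset.sum_subset hK fun q _ hq => ?_
      simp [eq_zero_of_notMem hq]
    rw [add_apply, key F (by intro; aesop), key G (by intro; aesop), key (F + G) (by intro; aesop),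
      ← Finset.sum_add_distrib]
    refine Finset.sum_congr rfl fun q _ => ?_
    rw [add_apply]; ring
  zero_mul F := ext' fun p x y => by simp [mul_apply]
  mul_zero F := ext' fun p x y => by simp [mul_apply]
  mul_assoc F G H := ext' fun p x y => by
    rw [mul_apply, mul_apply']
    simp only [mul_apply' F G, Finset.sum_mul]
    rw [finsum_sum_comm]
    · refine Finset.sum_congr rfl fun r _ => ?_
      rw [mul_apply, mul_finsum, ← finsum_comp_equiv (Equiv.addLeft r)]
      refine finsum_congr fun s => ?_
      simp only [Equiv.coe_addLeft]
      rw [mul_assoc]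
      congr 3
      · ring
      · ring
      · push_cast; ring
      · push_cast; ring
    · intro r _
      refine Set.Finite.subset (G.supp.image (fun s => r + s)).finite_toSet fun q hq => ?_
      by_contra h
      apply hq
      simp only [Finset.coe_image, Set.mem_image, not_exists, not_and] at h
      have hG : q - r ∉ G.supp := fun h' => h (q - r) h' (by ring)
      simp only [eq_zero_of_notMem hG, mul_zero, zero_mul]
  one_mul F := ext' fun p x y => by
    change ((single 0 _ _ _ _ : Pre c μ ν) * F) p x y = _
    rw [single_mul_apply]; simp
  mul_one F := ext' fun p x y => by
    rw [mul_apply, finsum_eq_single _ p]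
    · simp [one_apply]
    · intro q hq; simp [one_apply, sub_eq_zero, hq.symm]
  zsmul := zsmulRec

instance : Algebra ℂ (Pre c μ ν) :=
  letI : Module ℂ (Pre c μ ν) :=
    { one_smul := fun F => ext' fun p x y => by simp
      mul_smul := fun a b F => ext' fun p x y => by simp [mul_assoc]
      smul_zero := fun a => ext' fun p x y => by simp
      smul_add := fun a F G => ext' fun p x y => by simp [mul_add]
      add_smul := fun a b F => ext' fun p x y => by simp [add_mul]
      zero_smul := fun F => ext' fun p x y => by simp }
  Algebra.ofModule
    (fun a F G => ext' fun p x y => by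
      simp only [mul_apply, smul_apply, mul_finsum]
      exact finsum_congr fun q => by ring)
    (fun a F G => ext' fun p x y => by
      simp only [mul_apply, smul_apply, mul_finsum]
      exact finsum_congr fun q => by ring)

instance : StarRing (Pre c μ ν) where
  star_involutive F := ext' fun p x y => by
    simp only [star_apply, neg_neg, Complex.conj_conj]
    congr 1 <;> push_cast <;> ring
  star_mul F G := ext' fun p x y => by
    rw [star_apply, mul_apply, mul_apply, ← finsum_comp_equiv (Equiv.addLeft p)
        (f := fun q => (star G) q x y * (star F) (p - q) (x - 2 * q * μ) (y - 2 * q * ν)),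
      show ∀ f : ℤ → ℂ, (starRingEnd ℂ) (∑ᶠ q, f q) = ∑ᶠ q, (starRingEnd ℂ) (f q) from
        AddMonoidHom.map_finsum_of_injective (starRingEnd ℂ : ℂ →+ ℂ) star_injective]
    refine finsum_congr fun q => ?_
    simp only [map_mul, star_apply, Equiv.coe_addLeft]
    rw [mul_comm]
    congr 2
    · congr 1 <;> push_cast <;> ring
    · congr 1 <;> push_cast <;> ring
  star_add F G := ext' fun p x y => by simp [star_apply]

instance : StarModule ℂ (Pre c μ ν) where
  star_smul a F := ext' fun p x y => by simp [star_apply]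


/-! ### The universal C*-norm -/

/-- The universal C*-norm: the supremum of `‖ρ F‖` over all `*`-homomorphisms `ρ` from `D₀` to
C*-algebras. As `D₀` is generated by its elements of degree `0`, which are `C(T²)`, and of
degree `1`, which are the Hilbert bimodule, these are the covariant representations of the Hilbert
bimodule: `ρ ξ* ρ ζ = ρ (ξ* ζ)`, where `ξ* ζ` is the right scalar product of `ξ, ζ`, and similarly
for the other relations. -/
def uniNorm (F : Pre c μ ν) : ℝ :=
  sSup {r | ∃ (B : Type) (_ : NonUnitalCStarAlgebra B) (ρ : Pre c μ ν →⋆ₙₐ[ℂ] B), r = ‖ρ F‖}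

lemma exists_bound (F : Pre c μ ν) (p : ℤ) : ∃ M : ℝ, ∀ x y, ‖F p x y‖ ≤ M := by
  obtain ⟨M, hM⟩ := ((isCompact_Icc (a := (0 : ℝ)) (b := 1)).prod
    (isCompact_Icc (a := (0 : ℝ)) (b := 1))).exists_bound_of_continuousOn (F.cont p).continuousOn
  refine ⟨M, fun x y => ?_⟩
  have h1 : Function.Periodic (fun x => ‖F p x y‖) 1 := fun x => by
    simp [quasi, norm_e]
  have h2 : ∀ x, Function.Periodic (fun y => ‖F p x y‖) 1 := fun x y => by simp [peri]
  have e1 := h1.sub_int_mul_eq ⌊x⌋ (x := x)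
  have e2 := (h2 (x - ⌊x⌋)).sub_int_mul_eq ⌊y⌋ (x := y)
  simp only [mul_one] at e1 e2
  rw [← e1, ← e2]
  exact hM (Int.fract x, Int.fract y)
    ⟨⟨Int.fract_nonneg _, (Int.fract_lt_one _).le⟩, Int.fract_nonneg _, (Int.fract_lt_one _).le⟩

/-- The homogeneous component of degree `p`. -/
def comp (F : Pre c μ ν) (p : ℤ) : Pre c μ ν :=
  single p (F p) (F.cont p) (F.quasi p) (F.peri p)

lemma comp_apply (F : Pre c μ ν) (p q : ℤ) (x y : ℝ) :
    F.comp p q x y = if q = p then F p x y else 0 := rfl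

lemma sum_apply {ι : Type*} (S : Finset ι) (f : ι → Pre c μ ν) (p : ℤ) (x y : ℝ) :
    (∑ i ∈ S, f i) p x y = ∑ i ∈ S, f i p x y := by
  classical
  induction S using Finset.induction_on with
  | empty => simp
  | insert i S hi ih => simp [Finset.sum_insert hi, ih]

lemma sum_comp (F : Pre c μ ν) : ∑ p ∈ F.supp, F.comp p = F := ext' fun q x y => by
  rw [sum_apply]
  simp only [comp_apply, Finset.sum_ite_eq]
  split_ifs with h
  · rfl
  · rw [eq_zero_of_notMem h]

lemma star_comp_mul_comp (F : Pre c μ ν) (p q : ℤ) (x y : ℝ) :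
    (star (F.comp p) * F.comp p) q x y =
      if q = 0 then ((‖F p (x + 2 * p * μ) (y + 2 * p * ν)‖ ^ 2 : ℝ) : ℂ) else 0 := by
  rw [mul_apply, finsum_eq_single _ (-p)]
  · simp only [star_apply, comp_apply, neg_neg, if_true, sub_neg_eq_add]
    by_cases hq : q = 0
    · subst hq
      simp only [zero_add, if_true]
      rw [show x - 2 * ((-p : ℤ) : ℝ) * μ = x + 2 * p * μ by push_cast; ring,
        show y - 2 * ((-p : ℤ) : ℝ) * ν = y + 2 * p * ν by push_cast; ring,
        Complex.conj_mul']
      push_cast; rfl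
    · simp [hq]
  · intro r hr
    have : -r ≠ p := fun h => hr (by omega)
    simp [star_apply, comp_apply, this]

/-- A function whose existence bounds the norm of `F.comp p` in every representation. -/
lemma exists_sqrt (F : Pre c μ ν) (p : ℤ) (M : ℝ) (hM : ∀ x y, ‖F p x y‖ ≤ M) :
    ∃ g : Pre c μ ν, star (F.comp p) * F.comp p + star g * g = ((M ^ 2 : ℝ) : ℂ) • 1 := by
  let k : ℝ → ℝ → ℝ := fun x y =>
    Real.sqrt (M ^ 2 - ‖F p (x + 2 * p * μ) (y + 2 * p * ν)‖ ^ 2)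
  have hk : Continuous fun z : ℝ × ℝ => k z.1 z.2 := by
    have := (F.cont p).comp
      (by fun_prop : Continuous fun z : ℝ × ℝ => (z.1 + 2 * p * μ, z.2 + 2 * p * ν))
    exact Real.continuous_sqrt.comp (continuous_const.sub ((continuous_norm.comp this).pow 2))
  let g : Pre c μ ν := single 0 (fun x y => (k x y : ℂ))
    (Complex.continuous_ofReal.comp hk)
    (fun x y => by
      simp only [k]
      rw [show x + 1 + 2 * p * μ = x + 2 * p * μ + 1 by ring, quasi, norm_mul, norm_e]
      simp [e_zero])
    (fun x y => by
      simp only [k]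
      rw [show y + 1 + 2 * p * ν = y + 2 * p * ν + 1 by ring, peri])
  refine ⟨g, ext' fun q x y => ?_⟩
  have hg : g = g.comp 0 := ext' fun q x y => by
    simp only [comp_apply, g, single, mk']; split_ifs <;> rfl
  rw [hg, add_apply, star_comp_mul_comp, star_comp_mul_comp, smul_apply, one_apply]
  by_cases hq : q = 0
  · simp only [hq, if_true]
    have : ‖g 0 (x + 2 * ((0 : ℤ) : ℝ) * μ) (y + 2 * ((0 : ℤ) : ℝ) * ν)‖ ^ 2 =
        M ^ 2 - ‖F p (x + 2 * p * μ) (y + 2 * p * ν)‖ ^ 2 := by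
      simp only [g, single, mk', if_true, k, Int.cast_zero, mul_zero, zero_mul, add_zero]
      rw [Complex.norm_real, Real.norm_eq_abs, sq_abs, Real.sq_sqrt]
      have := hM (x + 2 * p * μ) (y + 2 * p * ν)
      have h0 := norm_nonneg (F p (x + 2 * p * μ) (y + 2 * p * ν))
      nlinarith
    rw [this]; push_cast; ring
  · simp [hq]

lemma exists_norm_bound (F : Pre c μ ν) : ∃ M : ℝ, ∀ (B : Type) (_ : NonUnitalCStarAlgebra B)
    (ρ : Pre c μ ν →⋆ₙₐ[ℂ] B), ‖ρ F‖ ≤ M := by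
  choose M hM using fun p => F.exists_bound p
  refine ⟨∑ p ∈ F.supp, M p, fun B _ ρ => ?_⟩
  conv_lhs => rw [← F.sum_comp]
  rw [map_sum]
  refine (norm_sum_le _ _).trans (Finset.sum_le_sum fun p _ => ?_)
  have hM0 : 0 ≤ M p := (norm_nonneg _).trans (hM p 0 0)
  obtain ⟨g, hg⟩ := F.exists_sqrt p (M p) (hM p)
  let _ := CStarAlgebra.spectralOrder B
  have _ := CStarAlgebra.spectralOrderedRing B
  have h1 : ‖ρ 1‖ ≤ 1 := by
    have : ‖star (ρ 1) * ρ 1‖ = ‖ρ 1‖ * ‖ρ 1‖ := CStarRing.norm_star_mul_self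
    rw [← map_star, ← map_mul, star_one, one_mul] at this
    by_contra hlt
    nlinarith
  have h2 : star (ρ (F.comp p)) * ρ (F.comp p) + star (ρ g) * ρ g =
      ((M p ^ 2 : ℝ) : ℂ) • ρ 1 := by
    rw [← map_star, ← map_star, ← map_mul, ← map_mul, ← map_add, hg, map_smul]
  have h3 : star (ρ (F.comp p)) * ρ (F.comp p) ≤ ((M p ^ 2 : ℝ) : ℂ) • ρ 1 := by
    rw [← h2]; exact le_add_of_nonneg_right (star_mul_self_nonneg _)
  have h4 := CStarAlgebra.norm_le_norm_of_nonneg_of_le (star_mul_self_nonneg _) h3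
  rw [CStarRing.norm_star_mul_self, norm_smul, Complex.norm_real, Real.norm_eq_abs,
    abs_of_nonneg (sq_nonneg _)] at h4
  have h5 : ‖ρ (F.comp p)‖ * ‖ρ (F.comp p)‖ ≤ M p ^ 2 :=
    h4.trans (mul_le_of_le_one_right (sq_nonneg _) h1)
  exact abs_le_of_sq_le_sq' (by nlinarith) hM0 |>.2

lemma bddAbove_uniNorm (F : Pre c μ ν) : BddAbove {r | ∃ (B : Type) (_ : NonUnitalCStarAlgebra B)
    (ρ : Pre c μ ν →⋆ₙₐ[ℂ] B), r = ‖ρ F‖} := by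
  obtain ⟨M, hM⟩ := F.exists_norm_bound
  exact ⟨M, by rintro _ ⟨B, i, ρ, rfl⟩; exact hM B i ρ⟩

lemma le_uniNorm (F : Pre c μ ν) {B : Type} [i : NonUnitalCStarAlgebra B]
    (ρ : Pre c μ ν →⋆ₙₐ[ℂ] B) : ‖ρ F‖ ≤ uniNorm F :=
  le_csSup F.bddAbove_uniNorm ⟨B, i, ρ, rfl⟩

lemma uniNorm_nonneg (F : Pre c μ ν) : 0 ≤ uniNorm F :=
  Real.sSup_nonneg (by rintro _ ⟨B, i, ρ, rfl⟩; exact norm_nonneg _)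

lemma uniNorm_le {F : Pre c μ ν} {M : ℝ} (hM : 0 ≤ M)
    (h : ∀ (B : Type) (_ : NonUnitalCStarAlgebra B) (ρ : Pre c μ ν →⋆ₙₐ[ℂ] B), ‖ρ F‖ ≤ M) :
    uniNorm F ≤ M :=
  Real.sSup_le (by rintro _ ⟨B, i, ρ, rfl⟩; exact h B i ρ) hM

/-- The universal C*-seminorm as a submultiplicative seminorm. -/
def uniSeminorm : RingSeminorm (Pre c μ ν) where
  toFun := uniNorm
  map_zero' := le_antisymm (uniNorm_le le_rfl fun B _ ρ => by simp) (uniNorm_nonneg _)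
  add_le' F G := uniNorm_le (add_nonneg (uniNorm_nonneg _) (uniNorm_nonneg _)) fun B _ ρ => by
    rw [map_add]
    exact (norm_add_le _ _).trans (add_le_add (le_uniNorm F ρ) (le_uniNorm G ρ))
  neg' F := by simp only [uniNorm, map_neg, norm_neg]
  mul_le' F G := uniNorm_le (mul_nonneg (uniNorm_nonneg _) (uniNorm_nonneg _)) fun B _ ρ => by
    rw [map_mul]
    exact (norm_mul_le _ _).trans
      (mul_le_mul (le_uniNorm F ρ) (le_uniNorm G ρ) (norm_nonneg _) (uniNorm_nonneg _))

instance : SeminormedRing (Pre c μ ν) := uniSeminorm.toSeminormedRing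

lemma norm_def (F : Pre c μ ν) : ‖F‖ = uniNorm F := rfl

instance : NormedAlgebra ℂ (Pre c μ ν) where
  norm_smul_le a F := uniNorm_le (mul_nonneg (norm_nonneg _) (uniNorm_nonneg _)) fun B _ ρ => by
    rw [map_smul, norm_smul]
    exact mul_le_mul_of_nonneg_left (le_uniNorm F ρ) (norm_nonneg _)

/-! ### The action of the Heisenberg group and the trace on `D₀` -/

/-- The Heisenberg group acts on `D₀` by `*`-automorphisms: in the coordinates
`g = (g 0, g 1, g 2) = (r, s, t)`, which stand for the upper unitriangular matrix with entries
`s`, `t / c` in the first row and `r` in the second,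
`α_g(F)(p, x, y) = e(-p (t + c s (x - r - p μ))) F(p, x - r, y - s)`. -/
def act (g : Fin 3 → ℝ) : Pre c μ ν →⋆ₐ[ℂ] Pre c μ ν where
  toFun F := mk'
    (fun p x y => e (-(p * (g 2 + c * g 1 * (x - g 0 - p * μ)))) * F p (x - g 0) (y - g 1))
    F.supp
    (fun p hp x y => by rw [eq_zero_of_notMem hp, mul_zero])
    (fun p => by
      refine (continuous_e.comp (by fun_prop)).mul ((F.cont p).comp
        (by fun_prop : Continuous fun z : ℝ × ℝ => (z.1 - g 0, z.2 - g 1))))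
    (fun p x y => by
      rw [show x + 1 - g 0 = x - g 0 + 1 by ring, quasi, ← mul_assoc, ← mul_assoc, ← e_add,
        ← e_add]
      congr 2; ring)
    (fun p x y => by rw [show y + 1 - g 1 = y - g 1 + 1 by ring, peri])
  map_one' := ext' fun p x y => by
    simp only [mk', one_apply]
    split_ifs with h <;> simp [h, e_zero]
  map_mul' F G := ext' fun p x y => by
    rw [mul_apply]
    simp only [mk', mul_apply, mul_finsum]
    refine finsum_congr fun q => ?_
    have h : e (-(p * (g 2 + c * g 1 * (x - g 0 - p * μ)))) =
        e (-(q * (g 2 + c * g 1 * (x - g 0 - q * μ)))) *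
        e (-(((p - q : ℤ) : ℝ) *
          (g 2 + c * g 1 * (x - 2 * q * μ - g 0 - ((p - q : ℤ) : ℝ) * μ)))) := by
      rw [← e_add]; congr 1; push_cast; ring
    rw [h, show x - 2 * q * μ - g 0 = x - g 0 - 2 * q * μ by ring,
      show y - 2 * q * ν - g 1 = y - g 1 - 2 * q * ν by ring]
    ring
  map_zero' := ext' fun p x y => by simp [mk']
  map_add' F G := ext' fun p x y => by simp [mk', mul_add]
  commutes' a := ext' fun p x y => by
    simp only [mk', Algebra.algebraMap_eq_smul_one, smul_apply, one_apply]
    split_ifs with h <;> simp [h, e_zero]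
  map_star' F := ext' fun p x y => by
    simp only [mk', star_apply, map_mul, conj_e]
    congr 2
    · push_cast; ring
    · congr 1 <;> ring

lemma act_apply (g : Fin 3 → ℝ) (F : Pre c μ ν) (p : ℤ) (x y : ℝ) :
    act g F p x y =
      e (-(p * (g 2 + c * g 1 * (x - g 0 - p * μ)))) * F p (x - g 0) (y - g 1) := rfl

/-- The group law of the Heisenberg group in the coordinates `(r, s, t)` is
`(r, s, t) (r', s', t') = (r + r', s + s', t + t' + c s r')`. -/
lemma act_act (g h : Fin 3 → ℝ) (F : Pre c μ ν) :
    act g (act h F) = act ![g 0 + h 0, g 1 + h 1, g 2 + h 2 + c * g 1 * h 0] F :=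
  ext' fun p x y => by
    simp only [act_apply, Matrix.cons_val]
    rw [← mul_assoc, ← e_add, show x - g 0 - h 0 = x - (g 0 + h 0) by ring,
      show y - g 1 - h 1 = y - (g 1 + h 1) by ring]
    congr 2
    ring

lemma norm_act_le (g : Fin 3 → ℝ) (F : Pre c μ ν) : ‖act g F‖ ≤ ‖F‖ :=
  uniNorm_le (uniNorm_nonneg _) fun _ _ ρ =>
    le_uniNorm F (ρ.comp (act g : Pre c μ ν →⋆ₐ[ℂ] Pre c μ ν).toNonUnitalStarAlgHom)

lemma continuous_act (g : Fin 3 → ℝ) : Continuous (act g : Pre c μ ν →⋆ₐ[ℂ] Pre c μ ν) :=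
  AddMonoidHomClass.continuous_of_bound (act g : Pre c μ ν →⋆ₐ[ℂ] Pre c μ ν) 1
    fun F => by simpa using norm_act_le g F


/-- The trace `F ↦ ∫₀¹ ∫₀¹ F(0, x, y) dy dx` on `D₀`. -/
def trace₀ (F : Pre c μ ν) : ℂ := ∫ x in (0 : ℝ)..1, ∫ y in (0 : ℝ)..1, F 0 x y

/-- The Hilbert space `ℓ²(ℤ)`. -/
abbrev L2 : Type := lp (fun _ : ℤ => ℂ) 2

/-- The operator `(S ξ)(m) = a(m) ξ(m + q)` on `ℓ²(ℤ)`, for a bounded sequence `a`. -/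
def wshift (a : ℤ → ℂ) (M : ℝ) (hM : ∀ m, ‖a m‖ ≤ M) (q : ℤ) : L2 →L[ℂ] L2 :=
  have hs : ∀ ξ : L2, Summable fun m : ℤ => ‖a m * ξ (m + q)‖ ^ (2 : ℝ) := fun ξ => by
    have h := (lp.memℓp ξ).summable (by norm_num)
    have h' := ((Equiv.addRight q).summable_iff.2 h).mul_left (M ^ 2)
    refine h'.of_nonneg_of_le (fun m => by positivity) fun m => ?_
    simp only [norm_mul, Function.comp_apply, Equiv.coe_addRight, ENNReal.toReal_ofNat,
      Real.rpow_ofNat, mul_pow]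
    gcongr
    exact hM m
  LinearMap.mkContinuous
    { toFun := fun ξ => ⟨fun m => a m * ξ (m + q), memℓp_gen (by simpa using hs ξ)⟩
      map_add' := fun ξ η => by ext m; exact mul_add _ _ _
      map_smul' := fun k ξ => by ext m; exact mul_left_comm _ _ _ }
    M fun ξ => by
      have hM0 : 0 ≤ M := (norm_nonneg _).trans (hM 0)
      have h := (lp.memℓp ξ).summable (by norm_num)
      refine lp.norm_le_of_tsum_le (by norm_num) (by positivity) ?_
      have h' := ((Equiv.addRight q).summable_iff.2 h).mul_left (M ^ 2)
      have e1 : (M * ‖ξ‖) ^ (2 : ENNReal).toReal =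
          ∑' m : ℤ, M ^ 2 * ‖ξ (m + q)‖ ^ (2 : ENNReal).toReal := by
        rw [Real.mul_rpow hM0 (norm_nonneg _), lp.norm_rpow_eq_tsum (by norm_num), tsum_mul_left,
          ← (Equiv.addRight q).tsum_eq]
        simp
      rw [e1]
      refine Summable.tsum_le_tsum (fun m => ?_) (by simpa using hs ξ) h'
      simp only [LinearMap.coe_mk, AddHom.coe_mk, norm_mul, ENNReal.toReal_ofNat,
        Real.rpow_ofNat, mul_pow]
      gcongr
      exact hM m

lemma wshift_apply (a : ℤ → ℂ) (M : ℝ) (hM) (q : ℤ) (ξ : L2) (m : ℤ) :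
    wshift a M hM q ξ m = a m * ξ (m + q) := rfl

lemma exists_bound_coeff (F : Pre c μ ν) (x y : ℝ) (q : ℤ) :
    ∃ M : ℝ, ∀ m : ℤ, ‖F q (x - 2 * m * μ) (y - 2 * m * ν)‖ ≤ M := by
  obtain ⟨M, hM⟩ := F.exists_bound q
  exact ⟨M, fun m => hM _ _⟩

/-- The regular representation of `D₀` on `ℓ²(ℤ)` at the point `(x, y)`. -/
def regFun (x y : ℝ) (F : Pre c μ ν) : L2 →L[ℂ] L2 :=
  ∑ q ∈ F.supp, wshift (fun m => F q (x - 2 * m * μ) (y - 2 * m * ν))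
    (F.exists_bound_coeff x y q).choose (F.exists_bound_coeff x y q).choose_spec q

lemma regFun_apply (x y : ℝ) (F : Pre c μ ν) (ξ : L2) (m : ℤ) :
    regFun x y F ξ m = ∑ q ∈ F.supp, F q (x - 2 * m * μ) (y - 2 * m * ν) * ξ (m + q) := by
  simp only [regFun, _root_.sum_apply, lp.coeFn_sum, Finset.sum_apply, wshift_apply]

lemma regFun_apply' (x y : ℝ) (F : Pre c μ ν) (ξ : L2) (m : ℤ) :
    regFun x y F ξ m = ∑ᶠ q : ℤ, F q (x - 2 * m * μ) (y - 2 * m * ν) * ξ (m + q) := by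
  rw [regFun_apply, finsum_eq F (fun q => ξ (m + q))]

lemma regFun_apply_of_subset (x y : ℝ) (F : Pre c μ ν) (ξ : L2) (m : ℤ) {S : Finset ℤ}
    (hS : F.supp ⊆ S) :
    regFun x y F ξ m = ∑ q ∈ S, F q (x - 2 * m * μ) (y - 2 * m * ν) * ξ (m + q) := by
  rw [regFun_apply]
  exact Finset.sum_subset hS fun q _ hq => by rw [eq_zero_of_notMem hq, zero_mul]

lemma regFun_inner (x y : ℝ) (F : Pre c μ ν) (ξ η : L2) :
    inner ℂ (regFun x y (star F) ξ) η = inner ℂ ξ (regFun x y F η) := by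
  let u : ℤ → L2 := fun q => wshift
    (fun m => (star F) (-q) (x - 2 * m * μ) (y - 2 * m * ν))
    ((star F).exists_bound_coeff x y (-q)).choose
    ((star F).exists_bound_coeff x y (-q)).choose_spec (-q) ξ
  let w : ℤ → L2 := fun q => wshift (fun m => F q (x - 2 * m * μ) (y - 2 * m * ν))
    (F.exists_bound_coeff x y q).choose (F.exists_bound_coeff x y q).choose_spec q η
  have hu : regFun x y (star F) ξ = ∑ q ∈ F.supp, u q := by
    ext m
    rw [regFun_apply', ← finsum_comp_equiv (Equiv.neg ℤ), lp.coeFn_sum, Finset.sum_apply]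
    apply finsum_eq_sum_of_support_subset
    intro q hq
    by_contra h
    refine hq ?_
    simp [star_apply, eq_zero_of_notMem (F := F) (p := q) (by simpa using h)]
  have hw : regFun x y F η = ∑ q ∈ F.supp, w q := by
    simp only [regFun, _root_.sum_apply, w]
  rw [hu, hw, sum_inner, inner_sum]
  refine Finset.sum_congr rfl fun q _ => ?_
  rw [lp.inner_eq_tsum, lp.inner_eq_tsum, ← (Equiv.addRight q).tsum_eq]
  refine tsum_congr fun m => ?_
  simp only [u, w, wshift_apply, Equiv.coe_addRight, RCLike.inner_apply, star_apply, map_mul,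
    Complex.conj_conj, neg_neg, add_neg_cancel_right]
  rw [show x - 2 * ((m + q : ℤ) : ℝ) * μ - 2 * ((-q : ℤ) : ℝ) * μ = x - 2 * m * μ by
      push_cast; ring,
    show y - 2 * ((m + q : ℤ) : ℝ) * ν - 2 * ((-q : ℤ) : ℝ) * ν = y - 2 * m * ν by
      push_cast; ring]
  ring

/-- The regular representation as a `*`-homomorphism. -/
def reg (x y : ℝ) : Pre c μ ν →⋆ₙₐ[ℂ] (L2 →L[ℂ] L2) where
  toFun := regFun x y
  map_smul' a F := by
    ext ξ m
    simp [regFun_apply', mul_assoc, mul_finsum]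
  map_zero' := by ext ξ m; simp [regFun_apply']
  map_add' F G := by
    ext ξ m
    have e1 := regFun_apply_of_subset x y (F + G) ξ m
      (S := F.supp ∪ G.supp ∪ (F + G).supp) (by intro; simp; tauto)
    have e2 := regFun_apply_of_subset x y F ξ m
      (S := F.supp ∪ G.supp ∪ (F + G).supp) (by intro; simp; tauto)
    have e3 := regFun_apply_of_subset x y G ξ m
      (S := F.supp ∪ G.supp ∪ (F + G).supp) (by intro; simp; tauto)
    rw [_root_.add_apply, lp.coeFn_add, Pi.add_apply, e1, e2, e3,
      ← Finset.sum_add_distrib]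
    exact Finset.sum_congr rfl fun q _ => by rw [add_apply, add_mul]
  map_mul' F G := by
    ext ξ m
    rw [mul_apply_eq_comp, regFun_apply', regFun_apply]
    simp only [mul_apply', Finset.sum_mul]
    rw [finsum_sum_comm]
    · refine Finset.sum_congr rfl fun r _ => ?_
      rw [regFun_apply', mul_finsum, ← finsum_comp_equiv (Equiv.addLeft r)]
      refine finsum_congr fun s => ?_
      simp only [Equiv.coe_addLeft]
      rw [mul_assoc, add_sub_cancel_left, add_assoc]
      congr 3
      · push_cast; ring
      · push_cast; ring
    · intro r _
      refine Set.Finite.subset (G.supp.image (fun s => r + s)).finite_toSet fun q hq => ?_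
      by_contra h
      apply hq
      simp only [Finset.coe_image, Set.mem_image, not_exists, not_and] at h
      have hG : q - r ∉ G.supp := fun h' => h (q - r) h' (by ring)
      simp only [eq_zero_of_notMem hG, mul_zero, zero_mul]
  map_star' F := by
    rw [ContinuousLinearMap.star_eq_adjoint, ContinuousLinearMap.eq_adjoint_iff]
    exact regFun_inner x y F

lemma norm_apply_zero_le (F : Pre c μ ν) (x y : ℝ) : ‖F 0 x y‖ ≤ ‖F‖ := by
  have h1 : ‖reg x y F‖ ≤ ‖F‖ := le_uniNorm F (reg x y)
  have h2 : reg x y F (lp.single 2 (0 : ℤ) (1 : ℂ)) 0 = F 0 x y := by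
    change regFun x y F _ 0 = _
    rw [regFun_apply', finsum_eq_single _ 0]
    · simp
    · intro q hq; simp [hq]
  rw [← h2]
  refine (lp.norm_apply_le_norm (by norm_num) _ _).trans ((ContinuousLinearMap.le_opNorm _ _).trans ?_)
  rw [lp.norm_single (by norm_num)]
  simpa using h1

/-- The trace on `D₀` as a bounded linear form. -/
def traceL : Pre c μ ν →L[ℂ] ℂ :=
  LinearMap.mkContinuous
    { toFun := trace₀
      map_add' := fun F G => by
        have hF : Continuous fun x => ∫ y in (0 : ℝ)..1, F 0 x y :=
          intervalIntegral.continuous_parametric_intervalIntegral_of_continuous' (F.cont 0) 0 1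
        have hG : Continuous fun x => ∫ y in (0 : ℝ)..1, G 0 x y :=
          intervalIntegral.continuous_parametric_intervalIntegral_of_continuous' (G.cont 0) 0 1
        simp only [trace₀, add_apply]
        rw [← intervalIntegral.integral_add (hF.intervalIntegrable 0 1)
          (hG.intervalIntegrable 0 1)]
        refine intervalIntegral.integral_congr fun x _ => ?_
        exact intervalIntegral.integral_add
          (((F.cont 0).comp (Continuous.prodMk_right x)).intervalIntegrable 0 1)
          (((G.cont 0).comp (Continuous.prodMk_right x)).intervalIntegrable 0 1)
      map_smul' := fun a F => by
        simp only [trace₀, smul_apply, intervalIntegral.integral_const_mul, RingHom.id_apply,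
          smul_eq_mul] }
    1 fun F => by
      have h : ‖trace₀ F‖ ≤ ‖F‖ * |(1 : ℝ) - 0| := by
        refine intervalIntegral.norm_integral_le_of_norm_le_const fun x _ => ?_
        have h' : ‖∫ y in (0 : ℝ)..1, F 0 x y‖ ≤ ‖F‖ * |(1 : ℝ) - 0| :=
          intervalIntegral.norm_integral_le_of_norm_le_const fun y _ => norm_apply_zero_le F x y
        simpa using h'
      rw [one_mul]
      exact h.trans_eq (by simp)

lemma norm_star_mul_self_ge (F : Pre c μ ν) : ‖F‖ * ‖F‖ ≤ ‖star F * F‖ := by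
  rw [← sq, ← Real.le_sqrt (norm_nonneg _) (norm_nonneg _), norm_def]
  refine uniNorm_le (Real.sqrt_nonneg _) fun B _ ρ => ?_
  refine Real.le_sqrt_of_sq_le ?_
  rw [sq, ← CStarRing.norm_star_mul_self, ← map_star, ← map_mul]
  exact le_uniNorm _ ρ

lemma norm_star_le (F : Pre c μ ν) : ‖star F‖ ≤ ‖F‖ :=
  uniNorm_le (uniNorm_nonneg _) fun _ _ ρ => by
    rw [map_star, norm_star]; exact le_uniNorm F ρ

lemma uniformContinuous_star : UniformContinuous (star : Pre c μ ν → Pre c μ ν) :=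
  uniformContinuous_addMonoidHom_of_continuous
    (f := (starAddEquiv : Pre c μ ν ≃+ Pre c μ ν).toAddMonoidHom)
    (AddMonoidHomClass.continuous_of_bound
      (starAddEquiv : Pre c μ ν ≃+ Pre c μ ν).toAddMonoidHom 1
      fun F => by simpa using norm_star_le F)

end Pre

end QHM

/-! ### Quantum Heisenberg manifolds -/

/-- The quantum Heisenberg manifold with parameters `c, μ, ν`: the completion of `D₀` for the
universal C*-norm. -/
abbrev QHM (c : ℤ) (μ ν : ℝ) : Type := UniformSpace.Completion (QHM.Pre c μ ν)

namespace QHM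

open UniformSpace UniformSpace.Completion
open scoped ContDiff

variable {c : ℤ} {μ ν : ℝ}

instance : NormedAlgebra ℂ (QHM c μ ν) where
  __ := (inferInstance : Algebra ℂ (QHM c μ ν))
  norm_smul_le := norm_smul_le

instance : Star (QHM c μ ν) := ⟨Completion.map star⟩

lemma coe_star (F : Pre c μ ν) : ((star F : Pre c μ ν) : QHM c μ ν) = star (F : QHM c μ ν) :=
  (Completion.map_coe Pre.uniformContinuous_star F).symm

lemma continuous_star' : Continuous (star : QHM c μ ν → QHM c μ ν) := Completion.continuous_map

instance : StarRing (QHM c μ ν) where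
  star_involutive a := by
    induction a using Completion.induction_on with
    | hp => exact isClosed_eq (continuous_star'.comp continuous_star') continuous_id
    | ih F => rw [← coe_star, ← coe_star, star_star]
  star_mul a b := by
    induction a, b using Completion.induction_on₂ with
    | hp =>
      exact isClosed_eq (continuous_star'.comp (by fun_prop))
        ((continuous_star'.comp continuous_snd).mul (continuous_star'.comp continuous_fst))
    | ih F G => simp only [← coe_star, ← coe_mul, star_mul]
  star_add a b := by
    induction a, b using Completion.induction_on₂ with
    | hp =>
      exact isClosed_eq (continuous_star'.comp (by fun_prop))
        ((continuous_star'.comp continuous_fst).add (continuous_star'.comp continuous_snd))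
    | ih F G => simp only [← coe_star, ← coe_add, star_add]

/-- The quantum Heisenberg manifold is a C*-algebra. -/
instance : CStarAlgebra (QHM c μ ν) where
  norm_mul_self_le a := by
    induction a using Completion.induction_on with
    | hp =>
      exact isClosed_le (by fun_prop)
        (continuous_norm.comp (continuous_star'.mul continuous_id))
    | ih F =>
      simp only [← coe_star, ← coe_mul, Completion.norm_coe]
      exact Pre.norm_star_mul_self_ge F
  star_smul k a := by
    induction a using Completion.induction_on with
    | hp =>
      exact isClosed_eq (continuous_star'.comp (continuous_const_smul k))
        (continuous_star'.const_smul (star k))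
    | ih F => simp only [← coe_star, ← Completion.coe_smul, star_smul]

/-- The action `α` of the Heisenberg group, in the coordinates `(r, s, t)`, on the quantum
Heisenberg manifold: the continuous extension of `Pre.act`. -/
def act (g : Fin 3 → ℝ) : QHM c μ ν →ₐ[ℂ] QHM c μ ν :=
  { Completion.mapRingHom (Pre.act g : Pre c μ ν →⋆ₐ[ℂ] Pre c μ ν).toAlgHom.toRingHom
      (Pre.continuous_act g) with
    commutes' := fun a => by
      change Completion.mapRingHom _ _ (algebraMap ℂ (Completion (Pre c μ ν)) a) = _
      rw [Completion.algebraMap_def, Completion.mapRingHom_coe]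
      congr 1
      exact (Pre.act g : Pre c μ ν →⋆ₐ[ℂ] Pre c μ ν).toAlgHom.commutes a }

/-- The invariant trace `τ`: the continuous extension of `F ↦ ∫₀¹ ∫₀¹ F(0, x, y) dy dx`. -/
def trace : QHM c μ ν →L[ℂ] ℂ := (Pre.traceL : Pre c μ ν →L[ℂ] ℂ).fromCompletion

/-- The smooth quantum Heisenberg manifold: the algebra of all `a` for which `g ↦ α_g(a)` is a
smooth function on the Heisenberg group. -/
def smooth (c : ℤ) (μ ν : ℝ) : Subalgebra ℂ (QHM c μ ν) where
  carrier := {a | ContDiff ℝ ∞ fun g : Fin 3 → ℝ => act g a}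
  mul_mem' {a b} ha hb := by
    change ContDiff ℝ ∞ fun g : Fin 3 → ℝ => act g (a * b)
    simp only [map_mul]
    exact ContDiff.mul ha hb
  add_mem' {a b} ha hb := by
    change ContDiff ℝ ∞ fun g : Fin 3 → ℝ => act g (a + b)
    simp only [map_add]
    exact ContDiff.add ha hb
  algebraMap_mem' k := by
    change ContDiff ℝ ∞ fun g : Fin 3 → ℝ => act g (algebraMap ℂ (QHM c μ ν) k)
    simp only [AlgHom.commutes]
    exact contDiff_const

/-- The Heisenberg derivations: `D 0 = ∂₁`, `D 1 = ∂₂`, `D 2 = ∂₃` are the infinitesimal generators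
of the action along the three coordinate one-parameter subgroups `(h, 0, 0)`, `(0, h, 0)`,
`(0, 0, h)` of the Heisenberg group. -/
def D (i : Fin 3) (a : QHM c μ ν) : QHM c μ ν :=
  deriv (fun h : ℝ => act (Pi.single i h) a) 0

/-- The degree `0` form `τ`. -/
def form0 (c : ℤ) (μ ν : ℝ) (a : Fin 1 → smooth c μ ν) : ℂ := trace (a 0 : QHM c μ ν)

/-- The degree `1` form `φ_i(a₀, a₁) = τ(a₀ ∂_i(a₁))`. -/
def form1 (c : ℤ) (μ ν : ℝ) (i : Fin 3) (a : Fin 2 → smooth c μ ν) : ℂ :=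
  trace ((a 0 : QHM c μ ν) * D i (a 1 : QHM c μ ν))

/-- The degree `2` form
`φ_{i,j}(a₀, a₁, a₂) = τ(a₀ (∂_i(a₁) ∂_j(a₂) - ∂_j(a₁) ∂_i(a₂)))`. -/
def form2 (c : ℤ) (μ ν : ℝ) (i j : Fin 3) (a : Fin 3 → smooth c μ ν) : ℂ :=
  trace ((a 0 : QHM c μ ν) * (D i (a 1 : QHM c μ ν) * D j (a 2 : QHM c μ ν) -
    D j (a 1 : QHM c μ ν) * D i (a 2 : QHM c μ ν)))

/-- The degree `3` form
`φ_{1,2,3}(a₀, a₁, a₂, a₃) = ∑_σ ε(σ) τ(a₀ ∂_{σ(1)}(a₁) ∂_{σ(2)}(a₂) ∂_{σ(3)}(a₃))`. -/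
def form3 (c : ℤ) (μ ν : ℝ) (a : Fin 4 → smooth c μ ν) : ℂ :=
  ∑ σ : Equiv.Perm (Fin 3), ((Equiv.Perm.sign σ : ℤ) : ℂ) *
    trace ((a 0 : QHM c μ ν) * D (σ 0) (a 1 : QHM c μ ν) * D (σ 1) (a 2 : QHM c μ ν) *
      D (σ 2) (a 3 : QHM c μ ν))

end QHM

/-! ### Cyclic cocycles -/

namespace CyclicCohomology

variable {A : Type*} [Ring A] [Algebra ℂ A]

/-- The Hochschild coboundary
`(bφ)(a⁰, …, aⁿ⁺¹) = ∑_{j ≤ n} (-1)ʲ φ(a⁰, …, aʲ aʲ⁺¹, …, aⁿ⁺¹) + (-1)ⁿ⁺¹ φ(aⁿ⁺¹ a⁰, a¹, …, aⁿ)`. -/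
def coboundary {n : ℕ} (φ : (Fin (n + 1) → A) → ℂ) (a : Fin (n + 2) → A) : ℂ :=
  ∑ j : Fin (n + 1), (-1) ^ (j : ℕ) * φ (Fin.contractNth j.castSucc (fun x y => x * y) a) +
    (-1) ^ (n + 1) *
      φ (Fin.cons (a (Fin.last (n + 1)) * a 0) fun i : Fin n => a i.succ.castSucc)

/-- A cyclic cocycle of degree `n`: an `(n + 1)`-linear form `φ` with
`φ(a⁰, …, aⁿ) = (-1)ⁿ φ(aⁿ, a⁰, …, aⁿ⁻¹)` and `bφ = 0`. -/
structure IsCyclicCocycle {n : ℕ} (φ : (Fin (n + 1) → A) → ℂ) : Prop where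
  multilinear : ∃ Φ : MultilinearMap ℂ (fun _ : Fin (n + 1) => A) ℂ, ∀ a, Φ a = φ a
  cyclic : ∀ a : Fin (n + 1) → A,
    φ a = (-1) ^ n * φ (Fin.cons (a (Fin.last n)) fun i : Fin n => a i.castSucc)
  closed : ∀ a : Fin (n + 2) → A, coboundary φ a = 0

end CyclicCohomology

end

/-! The cocycle identities follow formally from three facts: `τ` is a trace; it is invariant under
the Heisenberg action; the generators `∂ᵢ` are derivations of the smooth algebra with `[∂₂, ∂₁] = c
∂₃` and `∂₃` commuting with the others. Invariance gives `τ ∘ ∂ᵢ = 0`, that is, integration by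
parts.

Closedness: by the Leibniz rule the coboundary of `τ(a₀ ∂(a₁) ⋯ ∂(aₙ))` telescopes, and the trace
property cancels what is left. Neither antisymmetry nor commutation relations are needed. Cyclicity:
the trace carries `aₙ` to the end, and integration by parts takes the derivation off `a₀`. The
second-order terms this creates have to cancel under antisymmetrization. In degree 2 they do because
the two derivations commute, which is why one of them is `∂₃`. In degree 3 the relation `[∂₂, ∂₁] =
c ∂₃` leaves two terms containing `∂₃(a₁) ∂₃(a₂)`, with opposite signs
(`isCyclicCocycle_of_heisenberg`).

The trace property is checked on homogeneous components, where it is translation invariance of the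
integral over the torus (`Pre.trace₀_comp_mul_comp_comm`), and extends by density. On orbit maps `g
↦ α_g(a)` the derivation `∂ⱼ` acts as a left invariant vector field (`act_D`). Hence it preserves
smoothness (`D_mem_smooth`), and since second derivatives are symmetric, the commutators come only
from differentiating the fields (`D_D`, `D_comm`). -/

noncomputable section
-- Cyclic cocycles from an invariant trace and derivations
namespace CyclicCohomology

variable {A : Type*} [Ring A] [Algebra ℂ A]

/-- Makes the antisymmetrization explicit, so that cyclicity in degree 3 becomes an identity between
six-term sums. -/
lemma sum_sign_perm_fin_three (f : Fin 3 → Fin 3 → Fin 3 → ℂ) :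
    ∑ σ : Equiv.Perm (Fin 3), ((Equiv.Perm.sign σ : ℤ) : ℂ) * f (σ 0) (σ 1) (σ 2) =
      f 0 1 2 - f 1 0 2 - f 2 1 0 - f 0 2 1 + f 1 2 0 + f 2 0 1 := by
  have h : (Finset.univ : Finset (Equiv.Perm (Fin 3))) =
      {1, Equiv.swap 0 1, Equiv.swap 0 2, Equiv.swap 1 2, finRotate 3, (finRotate 3)⁻¹} := by
    decide
  have e1 : (finRotate 3) 0 = 1 ∧ (finRotate 3) 1 = 2 ∧ (finRotate 3) 2 = 0 := by decide
  have e2 : (finRotate 3)⁻¹ 0 = 2 ∧ (finRotate 3)⁻¹ 1 = 0 ∧ (finRotate 3)⁻¹ 2 = 1 := by decide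
  have e3 : Equiv.swap (0 : Fin 3) 1 2 = 2 := by decide
  have e4 : Equiv.swap (0 : Fin 3) 2 1 = 1 := by decide
  have e5 : Equiv.swap (1 : Fin 3) 2 0 = 0 := by decide
  have s1 : Equiv.Perm.sign (Equiv.swap (0 : Fin 3) 1) = -1 := by decide
  have s2 : Equiv.Perm.sign (Equiv.swap (0 : Fin 3) 2) = -1 := by decide
  have s3 : Equiv.Perm.sign (Equiv.swap (1 : Fin 3) 2) = -1 := by decide
  have s4 : Equiv.Perm.sign (finRotate 3) = 1 := by decide
  have s5 : Equiv.Perm.sign (finRotate 3)⁻¹ = 1 := by decide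
  rw [h, Finset.sum_insert (by decide), Finset.sum_insert (by decide),
    Finset.sum_insert (by decide), Finset.sum_insert (by decide), Finset.sum_insert (by decide),
    Finset.sum_singleton]
  simp only [s1, s2, s3, s4, s5, e1, e2, e3, e4, e5, Equiv.swap_apply_left,
    Equiv.swap_apply_right, Equiv.Perm.sign_one, Equiv.Perm.one_apply]
  push_cast
  ring

/-- The multilinear form `(a₀, …, aₙ) ↦ t(a₀ d₁(a₁) ⋯ dₙ(aₙ))`. -/
def monomialForm (t : A →ₗ[ℂ] ℂ) {n : ℕ} (d : Fin n → A →ₗ[ℂ] A) :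
    MultilinearMap ℂ (fun _ : Fin (n + 1) => A) ℂ :=
  t.compMultilinearMap ((MultilinearMap.mkPiAlgebraFin ℂ (n + 1) A).compLinearMap
    (Fin.cons LinearMap.id d))

lemma monomialForm_one (t : A →ₗ[ℂ] ℂ) (d : Fin 1 → A →ₗ[ℂ] A) (a : Fin 2 → A) :
    monomialForm t d a = t (a 0 * d 0 (a 1)) := by
  simp [monomialForm, List.ofFn_succ]

lemma monomialForm_two (t : A →ₗ[ℂ] ℂ) (d : Fin 2 → A →ₗ[ℂ] A) (a : Fin 3 → A) :
    monomialForm t d a = t (a 0 * d 0 (a 1) * d 1 (a 2)) := by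
  simp [monomialForm, List.ofFn_succ, mul_assoc]

lemma monomialForm_three (t : A →ₗ[ℂ] ℂ) (d : Fin 3 → A →ₗ[ℂ] A) (a : Fin 4 → A) :
    monomialForm t d a = t (a 0 * d 0 (a 1) * d 1 (a 2) * d 2 (a 3)) := by
  simp [monomialForm, List.ofFn_succ, mul_assoc]

/-! ### The Hochschild coboundary in degrees 0 to 3 -/

omit [Algebra ℂ A] in
lemma coboundary_zero (φ : (Fin 1 → A) → ℂ) (a : Fin 2 → A) :
    coboundary (n := 0) φ a = φ ![a 0 * a 1] - φ ![a 1 * a 0] := by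
  have h0 : Fin.contractNth (0 : Fin 2) (fun x y => x * y) a = ![a 0 * a 1] := by
    ext i; fin_cases i; rfl
  have h1 : (Fin.cons (a (Fin.last 1) * a 0) fun i : Fin 0 => a i.succ.castSucc : Fin 1 → A) =
      ![a 1 * a 0] := by
    ext i; fin_cases i; rfl
  simp only [coboundary]
  rw [h1, Fin.sum_univ_succ]
  simp only [Fin.castSucc_zero, h0]
  simp
  ring

omit [Algebra ℂ A] in
lemma coboundary_one (φ : (Fin 2 → A) → ℂ) (a : Fin 3 → A) :
    coboundary (n := 1) φ a =
      φ ![a 0 * a 1, a 2] - φ ![a 0, a 1 * a 2] + φ ![a 2 * a 0, a 1] := by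
  have h0 : Fin.contractNth (0 : Fin 2).castSucc (fun x y => x * y) a = ![a 0 * a 1, a 2] := by
    ext i; fin_cases i <;> rfl
  have h1 : Fin.contractNth (1 : Fin 2).castSucc (fun x y => x * y) a = ![a 0, a 1 * a 2] := by
    ext i; fin_cases i <;> rfl
  have h2 : (Fin.cons (a (Fin.last 2) * a 0) fun i : Fin 1 => a i.succ.castSucc : Fin 2 → A) =
      ![a 2 * a 0, a 1] := by
    ext i; fin_cases i <;> rfl
  -- Reads the index type `Fin (1 + 1)` as `Fin 2`, so that `Fin.sum_univ_two` applies.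
  change ∑ j : Fin 2, _ + _ = _
  rw [h2, Fin.sum_univ_two, h0, h1]
  norm_num
  ring

omit [Algebra ℂ A] in
lemma coboundary_two (φ : (Fin 3 → A) → ℂ) (a : Fin 4 → A) :
    coboundary (n := 2) φ a =
      φ ![a 0 * a 1, a 2, a 3] - φ ![a 0, a 1 * a 2, a 3] + φ ![a 0, a 1, a 2 * a 3] -
        φ ![a 3 * a 0, a 1, a 2] := by
  have h0 : Fin.contractNth (0 : Fin 3).castSucc (fun x y => x * y) a =
      ![a 0 * a 1, a 2, a 3] := by
    ext i; fin_cases i <;> rfl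
  have h1 : Fin.contractNth (1 : Fin 3).castSucc (fun x y => x * y) a =
      ![a 0, a 1 * a 2, a 3] := by
    ext i; fin_cases i <;> rfl
  have h2 : Fin.contractNth (2 : Fin 3).castSucc (fun x y => x * y) a =
      ![a 0, a 1, a 2 * a 3] := by
    ext i; fin_cases i <;> rfl
  have h3 : (Fin.cons (a (Fin.last 3) * a 0) fun i : Fin 2 => a i.succ.castSucc : Fin 3 → A) =
      ![a 3 * a 0, a 1, a 2] := by
    ext i; fin_cases i <;> rfl
  change ∑ j : Fin 3, _ + _ = _
  rw [h3, Fin.sum_univ_three, h0, h1, h2]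
  norm_num
  ring

omit [Algebra ℂ A] in
lemma coboundary_three (φ : (Fin 4 → A) → ℂ) (a : Fin 5 → A) :
    coboundary (n := 3) φ a =
      φ ![a 0 * a 1, a 2, a 3, a 4] - φ ![a 0, a 1 * a 2, a 3, a 4] +
        φ ![a 0, a 1, a 2 * a 3, a 4] - φ ![a 0, a 1, a 2, a 3 * a 4] +
        φ ![a 4 * a 0, a 1, a 2, a 3] := by
  have h0 : Fin.contractNth (0 : Fin 4).castSucc (fun x y => x * y) a =
      ![a 0 * a 1, a 2, a 3, a 4] := by
    ext i; fin_cases i <;> rfl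
  have h1 : Fin.contractNth (1 : Fin 4).castSucc (fun x y => x * y) a =
      ![a 0, a 1 * a 2, a 3, a 4] := by
    ext i; fin_cases i <;> rfl
  have h2 : Fin.contractNth (2 : Fin 4).castSucc (fun x y => x * y) a =
      ![a 0, a 1, a 2 * a 3, a 4] := by
    ext i; fin_cases i <;> rfl
  have h3 : Fin.contractNth (3 : Fin 4).castSucc (fun x y => x * y) a =
      ![a 0, a 1, a 2, a 3 * a 4] := by
    ext i; fin_cases i <;> rfl
  have h4 : (Fin.cons (a (Fin.last 4) * a 0) fun i : Fin 3 => a i.succ.castSucc : Fin 4 → A) =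
      ![a 4 * a 0, a 1, a 2, a 3] := by
    ext i; fin_cases i <;> rfl
  change ∑ j : Fin 4, _ + _ = _
  rw [h4, Fin.sum_univ_four, h0, h1, h2, h3]
  norm_num
  ring

/-- A trace on `A` is a cyclic cocycle of degree `0`. -/
theorem isCyclicCocycle_trace {t : A →ₗ[ℂ] ℂ} (ht : ∀ a b, t (a * b) = t (b * a)) :
    IsCyclicCocycle (n := 0) fun a : Fin 1 → A => t (a 0) where
  multilinear := ⟨monomialForm t Fin.elim0, fun a => by simp [monomialForm, List.ofFn_succ]⟩
  cyclic a := by simp [Fin.last]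
  closed a := by simp [coboundary_zero, ht (a 0)]

/-- For a trace `t` invariant under the derivation `d`, the form `t(a₀ d(a₁))` is a cyclic
cocycle. -/
theorem isCyclicCocycle_of_derivation {t : A →ₗ[ℂ] ℂ} (ht : ∀ a b, t (a * b) = t (b * a))
    {d : A →ₗ[ℂ] A} (hd : ∀ a b, d (a * b) = d a * b + a * d b) (htd : ∀ a, t (d a) = 0) :
    IsCyclicCocycle (n := 1) fun a : Fin 2 → A => t (a 0 * d (a 1)) where
  multilinear := ⟨monomialForm t ![d], fun a => by simp [monomialForm_one]⟩
  cyclic a := by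
    -- Integration by parts.
    have h := htd (a 0 * a 1)
    rw [hd, map_add, ht] at h
    change _ = (-1) ^ 1 * t (a 1 * d (a 0))
    linear_combination h
  closed a := by
    -- The cyclic term of the coboundary cancels the one Leibniz term with `a 2` at its right end.
    have h : t (a 2 * a 0 * d (a 1)) = t (a 0 * d (a 1) * a 2) := by rw [mul_assoc, ht]
    rw [coboundary_one]
    simp only [Matrix.cons_val, hd, mul_add, map_add, ← mul_assoc]
    linear_combination h

/-- For a trace `t` invariant under the commuting derivations `d, d'`, the form
`t(a₀ (d(a₁) d'(a₂) - d'(a₁) d(a₂)))` is a cyclic cocycle. -/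
theorem isCyclicCocycle_of_commuting_derivations {t : A →ₗ[ℂ] ℂ}
    (ht : ∀ a b, t (a * b) = t (b * a)) {d d' : A →ₗ[ℂ] A}
    (hd : ∀ a b, d (a * b) = d a * b + a * d b) (hd' : ∀ a b, d' (a * b) = d' a * b + a * d' b)
    (htd : ∀ a, t (d a) = 0) (htd' : ∀ a, t (d' a) = 0) (hdd' : ∀ a, d (d' a) = d' (d a)) :
    IsCyclicCocycle (n := 2) fun a : Fin 3 → A =>
      t (a 0 * (d (a 1) * d' (a 2) - d' (a 1) * d (a 2))) where
  multilinear := ⟨monomialForm t ![d, d'] - monomialForm t ![d', d], fun a => by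
    simp [monomialForm_two, mul_sub, mul_assoc]⟩
  cyclic a := by
    -- Integration by parts for both halves. In `h' - h` the terms with a second derivative of `a 1`
    -- cancel by `hdd'`, which is used nowhere else.
    have h := htd (a 0 * d' (a 1) * a 2)
    have h' := htd' (a 0 * d (a 1) * a 2)
    have e1 := ht (a 2) (d (a 0) * d' (a 1))
    have e2 := ht (a 2) (d' (a 0) * d (a 1))
    simp only [hd, hd', add_mul, map_add, ← mul_assoc, hdd'] at h h' e1 e2
    change _ = (-1) ^ 2 * t (a 2 * (d (a 0) * d' (a 1) - d' (a 0) * d (a 1)))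
    simp only [mul_sub, map_sub, ← mul_assoc]
    linear_combination h' - h - e1 + e2
  closed a := by
    -- The trace property brings `a 3` to the end; the two halves of the form then telescope
    -- separately.
    have h : ∀ x y : A, t (a 3 * a 0 * x * y) = t (a 0 * x * y * a 3) := fun x y => by
      rw [mul_assoc, mul_assoc, ht, ← mul_assoc]
    rw [coboundary_two]
    simp only [Matrix.cons_val, hd, hd', mul_add, add_mul, mul_sub, map_add, map_sub, ← mul_assoc,
      h]
    ring

/-- For a trace `t` invariant under derivations `d 0, d 1, d 2` that span the Heisenberg Lie
algebra, `d 2` being central, the antisymmetrization of `t(a₀ (d 0)(a₁) (d 1)(a₂) (d 2)(a₃))` is a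
cyclic cocycle. -/
theorem isCyclicCocycle_of_heisenberg {t : A →ₗ[ℂ] ℂ} (ht : ∀ a b, t (a * b) = t (b * a))
    {d : Fin 3 → A →ₗ[ℂ] A} (hd : ∀ i a b, d i (a * b) = d i a * b + a * d i b)
    (htd : ∀ i a, t (d i a) = 0) (h02 : ∀ a, d 0 (d 2 a) = d 2 (d 0 a))
    (h12 : ∀ a, d 1 (d 2 a) = d 2 (d 1 a)) {k : ℂ}
    (h10 : ∀ a, d 1 (d 0 a) = d 0 (d 1 a) + k • d 2 a) :
    IsCyclicCocycle (n := 3) fun a : Fin 4 → A =>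
      ∑ σ : Equiv.Perm (Fin 3), ((Equiv.Perm.sign σ : ℤ) : ℂ) *
        t (a 0 * d (σ 0) (a 1) * d (σ 1) (a 2) * d (σ 2) (a 3)) where
  multilinear := ⟨∑ σ : Equiv.Perm (Fin 3), ((Equiv.Perm.sign σ : ℤ) : ℂ) •
    monomialForm t fun i => d (σ i), fun a => by
      simp [monomialForm_three]⟩
  cyclic a := by
    -- Integration by parts: `d i` moves from `a 0` to the other three factors.
    have key : ∀ i j k, t (d i (a 0) * d j (a 1) * d k (a 2) * a 3) =
        -(t (a 0 * d i (d j (a 1)) * d k (a 2) * a 3) + t (a 0 * d j (a 1) * d i (d k (a 2)) * a 3)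
          + t (a 0 * d j (a 1) * d k (a 2) * d i (a 3))) := fun i j k => by
      have h := htd i (a 0 * d j (a 1) * d k (a 2) * a 3)
      simp only [hd, add_mul, map_add] at h
      linear_combination h
    have rot : ∀ x y z, t (a 3 * x * y * z) = t (x * y * z * a 3) := fun x y z => by
      rw [mul_assoc, mul_assoc, ht, ← mul_assoc]
    rw [sum_sign_perm_fin_three fun i j k => t (a 0 * d i (a 1) * d j (a 2) * d k (a 3))]
    change _ = (-1) ^ 3 * ∑ σ : Equiv.Perm (Fin 3), ((Equiv.Perm.sign σ : ℤ) : ℂ) *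
        t (a 3 * d (σ 0) (a 0) * d (σ 1) (a 1) * d (σ 2) (a 2))
    rw [sum_sign_perm_fin_three fun i j k => t (a 3 * d i (a 0) * d j (a 1) * d k (a 2))]
    -- Second-order terms are put in a fixed order. Those without `k` cancel in pairs. `h10`
    -- produces `k` once on `a 1` and once on `a 2`, each time multiplying `t (a 0 * d 2 (a 1) * d 2
    -- (a 2) * a 3)`, with opposite signs.
    simp only [rot, key, h02, h12, h10, mul_add, add_mul, map_add, mul_smul_comm, smul_mul_assoc,
      map_smul]
    ring
  closed a := by
    have h : ∀ x y z : A, t (a 4 * a 0 * x * y * z) = t (a 0 * x * y * z * a 4) := fun x y z => by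
      rw [mul_assoc, mul_assoc, mul_assoc, ht]; simp only [← mul_assoc]
    rw [coboundary_three, ← Finset.sum_sub_distrib, ← Finset.sum_add_distrib,
      ← Finset.sum_sub_distrib, ← Finset.sum_add_distrib]
    -- Each permutation contributes a Hochschild cocycle by itself.
    refine Finset.sum_eq_zero fun σ _ => ?_
    simp only [Matrix.cons_val, hd, mul_add, add_mul, map_add, ← mul_assoc, h]
    ring

end CyclicCohomology
-- The trace and its invariance
namespace QHM

/-- The integral of a periodic function over a period does not depend on where the period starts.
This serves both the invariance of the trace and the trace property. -/
lemma integral_integral_shift {H : ℝ → ℝ → ℂ} (h1 : ∀ x y, H (x + 1) y = H x y)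
    (h2 : ∀ x y, H x (y + 1) = H x y) (r s : ℝ) :
    ∫ x in (0 : ℝ)..1, ∫ y in (0 : ℝ)..1, H (x - r) (y - s) =
      ∫ x in (0 : ℝ)..1, ∫ y in (0 : ℝ)..1, H x y := by
  have key : ∀ {f : ℝ → ℂ}, Function.Periodic f 1 → ∀ u : ℝ,
      ∫ x in (0 : ℝ)..1, f (x - u) = ∫ x in (0 : ℝ)..1, f x := fun {f} hf u => by
    rw [intervalIntegral.integral_comp_sub_right f u]
    simpa [sub_eq_neg_add] using hf.intervalIntegral_add_eq (-u) 0
  have e1 : ∀ x, ∫ y in (0 : ℝ)..1, H (x - r) (y - s) = ∫ y in (0 : ℝ)..1, H (x - r) y :=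
    fun x => key (h2 (x - r)) s
  simp only [e1]
  exact key (f := fun x => ∫ y in (0 : ℝ)..1, H x y) (fun x => by simp only [h1]) r

variable {c : ℤ} {μ ν : ℝ}

namespace Pre

/-- Only degree 0 enters; there the phase is 1, so the group acts by translation on a doubly
periodic function. -/
lemma trace₀_act (g : Fin 3 → ℝ) (F : Pre c μ ν) : trace₀ (act g F) = trace₀ F := by
  simp only [trace₀, act_apply]
  simp only [Int.cast_zero, zero_mul, neg_zero, e_zero, one_mul]
  exact integral_integral_shift (fun x y => by simp [quasi, e_zero]) (F.peri 0) _ _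

/-- The product is homogeneous of degree `p + q`, so both sides vanish unless `q = -p`. In that case
the two integrands differ by the translation by `(2pμ, 2pν)`. -/
lemma trace₀_comp_mul_comp_comm (F G : Pre c μ ν) (p q : ℤ) :
    trace₀ (F.comp p * G.comp q) = trace₀ (G.comp q * F.comp p) := by
  have h : ∀ (F G : Pre c μ ν) (p q : ℤ) (x y : ℝ), (F.comp p * G.comp q) 0 x y =
      if p + q = 0 then F p x y * G q (x - 2 * p * μ) (y - 2 * p * ν) else 0 :=
    fun F G p q x y => by
      rw [comp, single_mul_apply, comp_apply]
      by_cases hpq : p + q = 0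
      · simp [hpq, show (0 : ℤ) - p = q by omega]
      · rw [if_neg hpq, if_neg (by omega), mul_zero]
  by_cases hpq : p + q = 0
  · obtain rfl : q = -p := by omega
    simp only [trace₀]
    rw [← integral_integral_shift (H := (F.comp p * G.comp (-p)) 0)
      (fun x y => by simp [quasi, e_zero]) (peri _ _) (-(2 * p * μ)) (-(2 * p * ν))]
    simp only [h, hpq, neg_add_cancel, if_true]
    refine intervalIntegral.integral_congr fun x _ => intervalIntegral.integral_congr fun y _ => ?_
    simp only [sub_neg_eq_add, add_sub_cancel_right]
    rw [mul_comm]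
    congr 2 <;> push_cast <;> ring
  · simp only [trace₀, h, add_comm q p, if_neg hpq]

lemma traceL_mul_comm (F G : Pre c μ ν) : traceL (F * G) = traceL (G * F) := by
  rw [← F.sum_comp, ← G.sum_comp]
  simp only [Finset.sum_mul, Finset.mul_sum, map_sum]
  rw [Finset.sum_comm]
  exact Finset.sum_congr rfl fun p _ => Finset.sum_congr rfl fun q _ =>
    trace₀_comp_mul_comp_comm F G p q

end Pre

/-! ### Extension to the completion by density -/

open UniformSpace UniformSpace.Completion
open scoped ContDiff

lemma act_coe (g : Fin 3 → ℝ) (F : Pre c μ ν) :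
    act g (F : QHM c μ ν) = ((Pre.act g F : Pre c μ ν) : QHM c μ ν) :=
  Completion.mapRingHom_coe (Pre.continuous_act g) F

lemma continuous_act (g : Fin 3 → ℝ) : Continuous (act g : QHM c μ ν → QHM c μ ν) :=
  Completion.continuous_map

lemma trace_coe (F : Pre c μ ν) : trace (F : QHM c μ ν) = Pre.traceL F :=
  ContinuousLinearMap.fromCompletion_apply_coe _ _

lemma trace_mul_comm (a b : QHM c μ ν) : trace (a * b) = trace (b * a) := by
  induction a, b using Completion.induction_on₂ with
  | hp => exact isClosed_eq (by fun_prop) (by fun_prop)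
  | ih F G => simp only [← coe_mul, trace_coe, Pre.traceL_mul_comm F G]

lemma trace_act (g : Fin 3 → ℝ) (a : QHM c μ ν) : trace (act g a) = trace a := by
  induction a using Completion.induction_on with
  | hp => exact isClosed_eq (trace.continuous.comp (continuous_act g)) (by fun_prop)
  | ih F =>
    rw [act_coe, trace_coe, trace_coe]
    exact Pre.trace₀_act g F

/-- The group law of the Heisenberg group in the coordinates `(r, s, t)` is
`(r, s, t) (r', s', t') = (r + r', s + s', t + t' + c s r')`. -/
lemma act_act (g h : Fin 3 → ℝ) (a : QHM c μ ν) :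
    act g (act h a) = act ![g 0 + h 0, g 1 + h 1, g 2 + h 2 + c * g 1 * h 0] a := by
  induction a using Completion.induction_on with
  | hp =>
    exact isClosed_eq ((continuous_act g).comp (continuous_act h)) (continuous_act _)
  | ih F => simp only [act_coe, Pre.act_act]

lemma act_zero (a : QHM c μ ν) : act 0 a = a := by
  induction a using Completion.induction_on with
  | hp => exact isClosed_eq (continuous_act 0) continuous_id
  | ih F =>
    rw [act_coe]
    congr 1
    exact Pre.ext' fun p x y => by simp [Pre.act_apply, e_zero]

/-! ### Generators of the action and left invariant vector fields -/

/-- The automorphism `α_g` as a continuous linear map. -/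
def actL (g : Fin 3 → ℝ) : QHM c μ ν →L[ℝ] QHM c μ ν where
  toLinearMap := (act g : QHM c μ ν →ₐ[ℂ] QHM c μ ν).toLinearMap.restrictScalars ℝ
  cont := continuous_act g

/-- The derivative at `h = 0` of the curve `g (h eⱼ)` in the Heisenberg group. -/
def leftInvariantField (c : ℤ) (j : Fin 3) (g : Fin 3 → ℝ) : Fin 3 → ℝ :=
  Pi.single j 1 + Pi.single 2 (c * g 1 * (Pi.single j 1 : Fin 3 → ℝ) 0)

/-- The group law is affine in its second argument, so `g (h eⱼ)` runs along a straight line,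
without terms of higher order in `h`. -/
lemma act_act_single (g : Fin 3 → ℝ) (j : Fin 3) (h : ℝ) (a : QHM c μ ν) :
    act g (act (Pi.single j h) a) = act (g + h • leftInvariantField c j g) a := by
  rw [act_act]
  congr 2
  ext i
  fin_cases j <;> fin_cases i <;> (simp [leftInvariantField]; try ring)

lemma hasDerivAt_act_act_single {a : QHM c μ ν} (ha : a ∈ smooth c μ ν) (g : Fin 3 → ℝ)
    (j : Fin 3) : HasDerivAt (fun h : ℝ => act g (act (Pi.single j h) a))
      (fderiv ℝ (fun g : Fin 3 → ℝ => act g a) g (leftInvariantField c j g)) 0 := by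
  have hf : ContDiff ℝ ∞ fun g : Fin 3 → ℝ => act g a := ha
  have h1 := (hf.differentiable (by simp) g).hasFDerivAt
  have h2 : HasDerivAt (fun h : ℝ => g + h • leftInvariantField c j g)
      (leftInvariantField c j g) 0 := by
    simpa using ((hasDerivAt_id (0 : ℝ)).smul_const (leftInvariantField c j g)).const_add g
  simp only [act_act_single]
  exact HasFDerivAt.comp_hasDerivAt (x := (0 : ℝ)) (l := fun g : Fin 3 → ℝ => act g a)
    (by simpa using h1) h2

/-- For smooth `a` the `deriv` defining `D` is a genuine derivative, not the default value 0. -/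
lemma hasDerivAt_act_single {a : QHM c μ ν} (ha : a ∈ smooth c μ ν) (j : Fin 3) :
    HasDerivAt (fun h : ℝ => act (Pi.single j h) a) (D j a) 0 := by
  have h := hasDerivAt_act_act_single ha 0 j
  simp only [act_zero] at h
  exact h.differentiableAt.hasDerivAt

/-- `α_g` is continuous and linear, so it passes through the derivative that defines `D j a`; the
chain rule along `g (h eⱼ)` computes the same derivative. -/
lemma act_D {a : QHM c μ ν} (ha : a ∈ smooth c μ ν) (g : Fin 3 → ℝ) (j : Fin 3) :
    act g (D j a) = fderiv ℝ (fun g : Fin 3 → ℝ => act g a) g (leftInvariantField c j g) :=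
  ((actL g).hasFDerivAt.comp_hasDerivAt (0 : ℝ) (hasDerivAt_act_single ha j)).unique
    (hasDerivAt_act_act_single ha g j)

lemma D_eq_fderiv {a : QHM c μ ν} (ha : a ∈ smooth c μ ν) (j : Fin 3) :
    D j a = fderiv ℝ (fun g : Fin 3 → ℝ => act g a) 0 (Pi.single j 1) := by
  rw [← act_zero (D j a), act_D ha]
  simp [leftInvariantField]

lemma contDiff_leftInvariantField (c : ℤ) (j : Fin 3) :
    ContDiff ℝ ∞ (leftInvariantField c j) := by
  rw [contDiff_pi]
  intro i
  fin_cases j <;> fin_cases i <;> simp [leftInvariantField] <;> fun_prop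

/-- By `act_D` the orbit map of `D j a` is the derivative of a smooth map along a field with affine
coefficients. -/
lemma D_mem_smooth {a : QHM c μ ν} (ha : a ∈ smooth c μ ν) (j : Fin 3) : D j a ∈ smooth c μ ν := by
  change ContDiff ℝ ∞ fun g : Fin 3 → ℝ => act g (D j a)
  simp only [act_D ha]
  have hf : ContDiff ℝ ∞ fun g : Fin 3 → ℝ => act g a := ha
  exact (hf.fderiv_right (m := ∞) (by simp)).clm_apply (contDiff_leftInvariantField c j)

/-- Product rule for `g ↦ f'(g)(Xⱼ(g))` at 0, where `f` is the orbit map and `Xⱼ` the left invariant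
field. The second summand comes from the derivative of `Xⱼ` in the direction `eᵢ`, which is nonzero
only for `X₀` in the direction `e₁` (indices in `Fin 3`), and then is a multiple of `e₂`. -/
lemma D_D {a : QHM c μ ν} (ha : a ∈ smooth c μ ν) (i j : Fin 3) :
    D i (D j a) =
      fderiv ℝ (fderiv ℝ fun g : Fin 3 → ℝ => act g a) 0 (Pi.single i 1) (Pi.single j 1) +
      (c * (Pi.single i 1 : Fin 3 → ℝ) 1 * (Pi.single j 1 : Fin 3 → ℝ) 0) • D 2 a := by
  have hf : ContDiff ℝ ∞ fun g : Fin 3 → ℝ => act g a := ha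
  have hf' : HasFDerivAt (fderiv ℝ fun g : Fin 3 → ℝ => act g a) _ 0 :=
    ((hf.fderiv_right (m := ∞) (by simp)).differentiable (by simp) 0).hasFDerivAt
  have hv : HasFDerivAt (leftInvariantField c j) (fderiv ℝ (leftInvariantField c j) 0) 0 :=
    ((contDiff_leftInvariantField c j).differentiable (by simp) 0).hasFDerivAt
  have hv' : fderiv ℝ (leftInvariantField c j) 0 (Pi.single i 1) =
      (c * (Pi.single i 1 : Fin 3 → ℝ) 1 * (Pi.single j 1 : Fin 3 → ℝ) 0) •
        (Pi.single 2 1 : Fin 3 → ℝ) := by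
    -- The derivative of the field is found by restricting it to the line `h eᵢ`, where it is an
    -- explicit affine function.
    have h1 : HasDerivAt (fun h : ℝ => leftInvariantField c j (h • Pi.single i 1)) _ 0 :=
      HasFDerivAt.comp_hasDerivAt (0 : ℝ) (l := leftInvariantField c j)
        (f := fun h : ℝ => h • (Pi.single i 1 : Fin 3 → ℝ))
        (by rw [zero_smul]; exact hv) ((hasDerivAt_id (0 : ℝ)).smul_const _)
    have h2 : HasDerivAt (fun h : ℝ => leftInvariantField c j (h • Pi.single i 1))
        ((c * (Pi.single i 1 : Fin 3 → ℝ) 1 * (Pi.single j 1 : Fin 3 → ℝ) 0) •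
          (Pi.single 2 1 : Fin 3 → ℝ)) 0 := by
      have h3 := (((hasDerivAt_id (0 : ℝ)).smul_const
        ((c * (Pi.single i 1 : Fin 3 → ℝ) 1 * (Pi.single j 1 : Fin 3 → ℝ) 0) •
          (Pi.single 2 1 : Fin 3 → ℝ))).const_add (Pi.single j 1))
      rw [one_smul] at h3
      have h4 : (fun h : ℝ => leftInvariantField c j (h • Pi.single i 1)) = fun h : ℝ =>
          Pi.single j 1 + id h • (c * (Pi.single i 1 : Fin 3 → ℝ) 1 *
            (Pi.single j 1 : Fin 3 → ℝ) 0) • (Pi.single 2 1 : Fin 3 → ℝ) := by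
        funext h
        simp only [leftInvariantField, id, ← Pi.single_smul, smul_eq_mul, Pi.smul_apply]
        congr 2
        ring
      rw [h4]
      exact h3
    simpa using h1.unique h2
  rw [D_eq_fderiv (D_mem_smooth ha j)]
  simp only [act_D ha]
  rw [(hf'.clm_apply hv).fderiv, D_eq_fderiv ha]
  simp only [add_apply, ContinuousLinearMap.coe_comp, Function.comp_apply, hv', map_smul,
    ContinuousLinearMap.flip_apply]
  rw [add_comm]
  simp [leftInvariantField]

/-- The commutation relations of the Heisenberg Lie algebra. -/
lemma D_comm {a : QHM c μ ν} (ha : a ∈ smooth c μ ν) (i j : Fin 3) :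
    D i (D j a) = D j (D i a) +
      (c * ((Pi.single i 1 : Fin 3 → ℝ) 1 * (Pi.single j 1 : Fin 3 → ℝ) 0 -
        (Pi.single j 1 : Fin 3 → ℝ) 1 * (Pi.single i 1 : Fin 3 → ℝ) 0)) • D 2 a := by
  have hf : ContDiff ℝ ∞ fun g : Fin 3 → ℝ => act g a := ha
  -- By symmetry of the second derivative, only the correction terms of `D_D` survive in the
  -- commutator.
  have hs : IsSymmSndFDerivAt ℝ (fun g : Fin 3 → ℝ => act g a) 0 :=
    (hf.of_le (m := 2) (by exact WithTop.coe_le_coe.2 le_top)).contDiffAt.isSymmSndFDerivAt (by simp)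
  rw [D_D ha, D_D ha, hs.eq, add_assoc, ← add_smul]
  congr 2
  ring

lemma D_mul {a b : QHM c μ ν} (ha : a ∈ smooth c μ ν) (hb : b ∈ smooth c μ ν) (i : Fin 3) :
    D i (a * b) = D i a * b + a * D i b := by
  have h := (hasDerivAt_act_single ha i).mul (hasDerivAt_act_single hb i)
  simp only [Pi.single_zero, act_zero] at h
  refine HasDerivAt.deriv ?_
  simp only [map_mul]
  exact h

/-- By invariance of the trace, `h ↦ τ(α_h(a))` is constant along the one-parameter subgroup. -/
lemma trace_D {a : QHM c μ ν} (ha : a ∈ smooth c μ ν) (i : Fin 3) : trace (D i a) = 0 := by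
  have h := ((trace : QHM c μ ν →L[ℂ] ℂ).restrictScalars ℝ).hasFDerivAt.comp_hasDerivAt (0 : ℝ)
    (hasDerivAt_act_single ha i)
  refine h.unique (?_ : HasDerivAt (fun h : ℝ => trace (act (Pi.single i h) a)) 0 0)
  simp only [trace_act]
  exact hasDerivAt_const _ _

/-! ### Trace and derivations on the smooth subalgebra -/

/-- The derivation `∂ᵢ` of the smooth quantum Heisenberg manifold. -/
def smoothD (c : ℤ) (μ ν : ℝ) (i : Fin 3) : smooth c μ ν →ₗ[ℂ] smooth c μ ν where
  toFun a := ⟨D i a, D_mem_smooth a.2 i⟩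
  map_add' a b := Subtype.ext <| HasDerivAt.deriv <| by
    simp only [Subalgebra.coe_add, map_add]
    exact (hasDerivAt_act_single a.2 i).add (hasDerivAt_act_single b.2 i)
  map_smul' k a := Subtype.ext <| HasDerivAt.deriv <| by
    simp only [Subalgebra.coe_smul, map_smul]
    exact (hasDerivAt_act_single a.2 i).const_smul k

/-- The trace on the smooth quantum Heisenberg manifold. -/
def smoothTrace (c : ℤ) (μ ν : ℝ) : smooth c μ ν →ₗ[ℂ] ℂ :=
  (trace : QHM c μ ν →L[ℂ] ℂ).toLinearMap ∘ₗ (smooth c μ ν).val.toLinearMap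

lemma smoothTrace_mul_comm (a b : smooth c μ ν) :
    smoothTrace c μ ν (a * b) = smoothTrace c μ ν (b * a) := trace_mul_comm _ _

lemma smoothTrace_smoothD (i : Fin 3) (a : smooth c μ ν) :
    smoothTrace c μ ν (smoothD c μ ν i a) = 0 := trace_D a.2 i

lemma smoothD_mul (i : Fin 3) (a b : smooth c μ ν) :
    smoothD c μ ν i (a * b) = smoothD c μ ν i a * b + a * smoothD c μ ν i b :=
  Subtype.ext (D_mul a.2 b.2 i)

lemma smoothD_zero_two (a : smooth c μ ν) :
    smoothD c μ ν 0 (smoothD c μ ν 2 a) = smoothD c μ ν 2 (smoothD c μ ν 0 a) :=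
  Subtype.ext ((D_comm a.2 0 2).trans (by simp [smoothD]))

lemma smoothD_one_two (a : smooth c μ ν) :
    smoothD c μ ν 1 (smoothD c μ ν 2 a) = smoothD c μ ν 2 (smoothD c μ ν 1 a) :=
  Subtype.ext ((D_comm a.2 1 2).trans (by simp [smoothD]))

lemma smoothD_one_zero (a : smooth c μ ν) :
    smoothD c μ ν 1 (smoothD c μ ν 0 a) =
      smoothD c μ ν 0 (smoothD c μ ν 1 a) + (c : ℂ) • smoothD c μ ν 2 a :=
  Subtype.ext ((D_comm a.2 1 0).trans (by
    simp [smoothD]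
    -- `D_comm` has `c` as a real scalar, here it is complex; both act as the integer `c`.
    rw [Int.cast_smul_eq_zsmul ℝ, Int.cast_smul_eq_zsmul ℂ]))

/-- This and the next three equalities put the forms in the shape of the general cocycle theorems.
They are definitional, as the operations of the subalgebra are those of the ambient algebra. -/
lemma form0_eq : form0 c μ ν = fun a => smoothTrace c μ ν (a 0) := rfl

lemma form1_eq (i : Fin 3) :
    form1 c μ ν i = fun a => smoothTrace c μ ν (a 0 * smoothD c μ ν i (a 1)) := rfl

lemma form2_eq (i j : Fin 3) :
    form2 c μ ν i j = fun a => smoothTrace c μ ν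
      (a 0 * (smoothD c μ ν i (a 1) * smoothD c μ ν j (a 2) -
        smoothD c μ ν j (a 1) * smoothD c μ ν i (a 2))) := rfl

lemma form3_eq :
    form3 c μ ν = fun a => ∑ σ : Equiv.Perm (Fin 3), ((Equiv.Perm.sign σ : ℤ) : ℂ) *
      smoothTrace c μ ν (a 0 * smoothD c μ ν (σ 0) (a 1) * smoothD c μ ν (σ 1) (a 2) *
        smoothD c μ ν (σ 2) (a 3)) := rfl

end QHM

end

theorem mainTheorem6 (c : ℤ) (hc : 0 < c) (μ ν : ℝ) :
    CyclicCohomology.IsCyclicCocycle (n := 0) (QHM.form0 c μ ν) ∧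
    (∀ i : Fin 3, CyclicCohomology.IsCyclicCocycle (n := 1) (QHM.form1 c μ ν i)) ∧
    CyclicCohomology.IsCyclicCocycle (n := 2) (QHM.form2 c μ ν 0 2) ∧
    CyclicCohomology.IsCyclicCocycle (n := 2) (QHM.form2 c μ ν 1 2) ∧
    CyclicCohomology.IsCyclicCocycle (n := 3) (QHM.form3 c μ ν) := by
  simp only [QHM.form0_eq, QHM.form1_eq, QHM.form2_eq, QHM.form3_eq]
  exact ⟨CyclicCohomology.isCyclicCocycle_trace (t := QHM.smoothTrace c μ ν) QHM.smoothTrace_mul_comm,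
    fun i => CyclicCohomology.isCyclicCocycle_of_derivation
      (t := QHM.smoothTrace c μ ν) QHM.smoothTrace_mul_comm
      (QHM.smoothD_mul i) (QHM.smoothTrace_smoothD i),
    CyclicCohomology.isCyclicCocycle_of_commuting_derivations
      (t := QHM.smoothTrace c μ ν) QHM.smoothTrace_mul_comm
      (QHM.smoothD_mul 0) (QHM.smoothD_mul 2) (QHM.smoothTrace_smoothD 0) (QHM.smoothTrace_smoothD 2)
      QHM.smoothD_zero_two,
    CyclicCohomology.isCyclicCocycle_of_commuting_derivations
      (t := QHM.smoothTrace c μ ν) QHM.smoothTrace_mul_comm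
      (QHM.smoothD_mul 1) (QHM.smoothD_mul 2) (QHM.smoothTrace_smoothD 1) (QHM.smoothTrace_smoothD 2)
      QHM.smoothD_one_two,
    CyclicCohomology.isCyclicCocycle_of_heisenberg (t := QHM.smoothTrace c μ ν)
      QHM.smoothTrace_mul_comm QHM.smoothD_mul
      QHM.smoothTrace_smoothD QHM.smoothD_zero_two QHM.smoothD_one_two QHM.smoothD_one_zero⟩
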